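/- Let $\mathbb K$ be a field and let $F\in\mathbb K\langle x,y\rangle$ be a potential, that is, a cyclically invariant element of the free associative algebra in two variables (words that are cyclic permutations of each other have equal coefficients in $F$). $F$ need not be homogeneous. Let $\frac{\partial}{\partial x},\frac{\partial}{\partial y}:\mathbb K\langle x,y\rangle\to\mathbb K\langle x,y\rangle$ be the linear maps given on monomials by $\frac{\partial w}{\partial x}=u$ if $w=xu$ and $\frac{\partial w}{\partial x}=0$ otherwise, and $\frac{\partial w}{\partial y}=u$ if $w=yu$ and $\frac{\partial w}{\partial y}=0$ otherwise. Let $A_F=\mathbb K\langle x,y\rangle/I_F$, where $I_F$ is the two-sided ideal generated by $\frac{\partial F}{\partial x}$ and $\frac{\partial F}{\partial y}$. If all terms of $F$ have degree at least $5$, then $A_F$ is infinite dimensional over $\mathbb K$. -/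

import Mathlib

namespace PotentialAlgebra

/-- The free associative algebra `𝕜⟨x, y⟩`; its generators are `x = FreeAlgebra.ι 𝕜 0` and
`y = FreeAlgebra.ι 𝕜 1`. -/
abbrev FreeAlg (𝕜 : Type*) [Field 𝕜] : Type _ := FreeAlgebra 𝕜 (Fin 2)

/-- Words in the two letters `x` (the letter `0`) and `y` (the letter `1`). -/
abbrev Word : Type := FreeMonoid (Fin 2)

/-- The monomial of `𝕜⟨x, y⟩` spelled by the word `w`. -/
noncomputable def monomial (𝕜 : Type*) [Field 𝕜] (w : Word) : FreeAlg 𝕜 :=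
  FreeAlgebra.basisFreeMonoid 𝕜 (Fin 2) w

/-- The coefficient in `F` of the monomial spelled by the word `w`. -/
noncomputable def coeff {𝕜 : Type*} [Field 𝕜] (F : FreeAlg 𝕜) (w : Word) : 𝕜 :=
  (FreeAlgebra.basisFreeMonoid 𝕜 (Fin 2)).repr F w

/-- `F` is cyclically invariant: words which are cyclic permutations of each other have the same
coefficient in `F`. -/
def IsCyclicallyInvariant {𝕜 : Type*} [Field 𝕜] (F : FreeAlg 𝕜) : Prop :=
  ∀ u v : Word, coeff F (u * v) = coeff F (v * u)

/-- All terms of `F` have degree at least `d`. -/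
def HasTermsOfDegreeGE {𝕜 : Type*} [Field 𝕜] (d : ℕ) (F : FreeAlg 𝕜) : Prop :=
  ∀ w : Word, coeff F w ≠ 0 → d ≤ w.length

/-- The partial derivative of the monomial spelled by a word with respect to the letter `i`:
a first letter `i` is removed, and a word that does not start with `i` is sent to zero. -/
noncomputable def wordDeriv (𝕜 : Type*) [Field 𝕜] (i : Fin 2) : List (Fin 2) → FreeAlg 𝕜
  | [] => 0
  | a :: u => if a = i then monomial 𝕜 (FreeMonoid.ofList u) else 0

/-- The linear map `∂/∂x` (for `i = 0`) or `∂/∂y` (for `i = 1`) on `𝕜⟨x, y⟩`. -/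
noncomputable def pderiv {𝕜 : Type*} [Field 𝕜] (i : Fin 2) : FreeAlg 𝕜 →ₗ[𝕜] FreeAlg 𝕜 :=
  (FreeAlgebra.basisFreeMonoid 𝕜 (Fin 2)).constr 𝕜 fun w => wordDeriv 𝕜 i (FreeMonoid.toList w)

/-- The two-sided ideal generated by `∂F/∂x` and `∂F/∂y`. -/
noncomputable def potentialIdeal {𝕜 : Type*} [Field 𝕜] (F : FreeAlg 𝕜) :
    TwoSidedIdeal (FreeAlg 𝕜) :=
  TwoSidedIdeal.span {pderiv 0 F, pderiv 1 F}

/-- The algebra `A_F = 𝕜⟨x, y⟩ / (∂F/∂x, ∂F/∂y)`. -/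
abbrev PotentialAlg {𝕜 : Type*} [Field 𝕜] (F : FreeAlg 𝕜) : Type _ :=
  (potentialIdeal F).ringCon.Quotient

end PotentialAlgebra

/-!
The algebra `A_F` is compared with the one of a potential whose Gröbner basis is transparent. Let
`F₀` be the sum of the four cyclic rotations of `xxyy`, with derivatives `xyy + yyx` and
`xxy + yxx`, and deform `F` to `F₀ + t F` over the field `𝕜(t)`.

Since `F` has no terms of degree below `5`, the derivatives of `F₀ + t F` have the derivatives of
`F₀` as their parts of lowest degree. For the order in which low degree leads, and below any fixed
degree `N`, they form a Gröbner basis with leading words `xyy` and `xxy`: these words have a single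
overlap, `xxyy`, and it is resolved exactly by the syzygy `x ∂ₓ + y ∂ᵧ = ∂ₓ x + ∂ᵧ y` satisfied by
the derivatives of any potential (`IsDeformation.exchange_of_le`). The powers of `y` contain no
leading word, so below degree `N` the deformed ideal has codimension at least `N`
(`IsDeformation.finrank_add_le`).

The rank of a family of vectors over `𝕜` cannot drop when they are deformed with a transcendental
parameter (`LinearIndependent.add_transcendental_smul`). Hence the ideal of `F`, truncated below
degree `N`, has codimension at least `N` as well, and `A_F`, which maps onto the truncated
quotient, has dimension at least `N` for every `N`.
-/

/-! ### Semicontinuity of the rank -/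

/-- Semicontinuity of the rank: vectors `a k + t b k`, with `t` transcendental over the field of
definition of `a` and `b`, are linearly independent if the `b k` are. If `C` is a right inverse of
the matrix with rows `b k`, then `(a + t b) C = t + a C`, whose determinant is the characteristic
polynomial of `-a C` evaluated at `t`. -/
theorem LinearIndependent.add_transcendental_smul {𝕜 L : Type*} [Field 𝕜] [Field L] [Algebra 𝕜 L]
    {t : L} (ht : Transcendental 𝕜 t) {κ W : Type*} [Finite κ] [Finite W] {b : κ → W → 𝕜}
    (hb : LinearIndependent 𝕜 b) (a : κ → W → 𝕜) :
    LinearIndependent L fun k w => algebraMap 𝕜 L (a k w) + t * algebraMap 𝕜 L (b k w) := by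
  classical
  have := Fintype.ofFinite κ
  have := Fintype.ofFinite W
  obtain ⟨C, hC⟩ : ∃ C : Matrix W κ 𝕜, Matrix.of b * C = 1 := by
    have hinj := Matrix.vecMul_injective_iff.2 (show LinearIndependent 𝕜 (Matrix.of b).row from hb)
    obtain ⟨g, hg⟩ := (Matrix.vecMulLinear (Matrix.of b)).exists_leftInverse_of_injective
      (LinearMap.ker_eq_bot.2 hinj)
    refine ⟨(LinearMap.toMatrix' g).transpose, Matrix.ext_of_single_vecMul fun k => ?_⟩
    rw [← Matrix.vecMul_vecMul, Matrix.vecMul_transpose, LinearMap.toMatrix'_mulVec,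
      Matrix.vecMul_one]
    exact LinearMap.congr_fun hg (Pi.single k 1)
  set φ := algebraMap 𝕜 L
  set M : Matrix κ W L := (Matrix.of a).map φ + t • (Matrix.of b).map φ with hM
  have hMC : M * C.map φ = Matrix.scalar κ t - (-(Matrix.of a * C)).map φ := by
    have ha : (Matrix.of a).map φ * C.map φ = (Matrix.of a * C).map φ := Matrix.map_mul.symm
    have hb' : (Matrix.of b).map φ * C.map φ = 1 := by
      rw [← Matrix.map_mul, hC, Matrix.map_one _ (map_zero φ) (map_one φ)]
    rw [hM, Matrix.add_mul, Matrix.smul_mul, ha, hb', Matrix.smul_one_eq_diagonal]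
    ext i j
    simp [add_comm, -Matrix.map_mul]
  have hdet : (M * C.map φ).det ≠ 0 := by
    rw [hMC, ← Matrix.eval_charpoly, Matrix.charpoly_map, Polynomial.eval_map_algebraMap]
    exact fun h => ht ⟨_, (Matrix.charpoly_monic _).ne_zero, h⟩
  have hrow : LinearIndependent L (M * C.map φ).row :=
    Matrix.linearIndependent_rows_of_isUnit ((Matrix.isUnit_iff_isUnit_det _).2 hdet.isUnit)
  have hMrow : LinearIndependent L M.row := by
    rw [← Matrix.vecMul_injective_iff] at hrow ⊢
    intro v v' h
    refine hrow ?_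
    simp only [← Matrix.vecMul_vecMul]
    exact congrArg (Matrix.vecMul · (C.map φ)) h
  exact hMrow

namespace PotentialAlgebra

open Module

variable {𝕜 L : Type*} [Field 𝕜] [Field L]

/-! ### Monomials, coefficients and derivatives -/

/-- The monomial spelled by a list of letters. Words are handled as lists throughout, since the
argument is about concatenation, prefixes and lengths. -/
noncomputable def mon (𝕜 : Type*) [Field 𝕜] (w : List (Fin 2)) : FreeAlg 𝕜 :=
  monomial 𝕜 (FreeMonoid.ofList w)

theorem monomial_eq (w : Word) :
    monomial 𝕜 w = (FreeAlgebra.equivMonoidAlgebraFreeMonoid (R := 𝕜) (X := Fin 2)).symm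
      (MonoidAlgebra.single w 1) := by
  simp [monomial, FreeAlgebra.basisFreeMonoid]

theorem mon_append (u v : List (Fin 2)) : mon 𝕜 (u ++ v) = mon 𝕜 u * mon 𝕜 v := by
  simp [mon, monomial_eq, ← map_mul, MonoidAlgebra.single_mul_single]

theorem mon_cons (a : Fin 2) (u : List (Fin 2)) : mon 𝕜 (a :: u) = mon 𝕜 [a] * mon 𝕜 u :=
  mon_append [a] u

theorem mon_nil : mon 𝕜 [] = 1 := by
  simp [mon, monomial_eq, ← MonoidAlgebra.one_def]

theorem mon_singleton (a : Fin 2) : mon 𝕜 [a] = FreeAlgebra.ι 𝕜 a := by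
  simp [mon, monomial_eq, FreeAlgebra.equivMonoidAlgebraFreeMonoid]

theorem coeff_mon (w w' : List (Fin 2)) :
    coeff (mon 𝕜 w) (FreeMonoid.ofList w') = if w = w' then 1 else 0 := by
  rw [coeff, mon, monomial, Basis.repr_self]
  classical
  exact Finsupp.single_apply.trans (if_congr FreeMonoid.ofList.injective.eq_iff rfl rfl)

theorem pderiv_mon (i : Fin 2) (w : List (Fin 2)) : pderiv i (mon 𝕜 w) = wordDeriv 𝕜 i w := by
  simp only [pderiv, mon, monomial, Basis.constr_basis]
  rfl

theorem span_mon : Submodule.span 𝕜 (Set.range (mon 𝕜)) = ⊤ :=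
  (FreeAlgebra.basisFreeMonoid 𝕜 (Fin 2)).span_eq

/-- The coefficient of the word `w`, as a linear functional. -/
noncomputable def coeffHom (𝕜 : Type*) [Field 𝕜] (w : List (Fin 2)) : FreeAlg 𝕜 →ₗ[𝕜] 𝕜 :=
  (FreeAlgebra.basisFreeMonoid 𝕜 (Fin 2)).coord (FreeMonoid.ofList w)

theorem coeffHom_mon (w w' : List (Fin 2)) :
    coeffHom 𝕜 w (mon 𝕜 w') = if w' = w then 1 else 0 := coeff_mon w' w

theorem ext_coeffHom {F G : FreeAlg 𝕜} (h : ∀ w, coeffHom 𝕜 w F = coeffHom 𝕜 w G) : F = G :=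
  (FreeAlgebra.basisFreeMonoid 𝕜 (Fin 2)).ext_elem fun w => h w.toList

theorem hom_ext_mon {M : Type*} [AddCommGroup M] [Module 𝕜 M] {f g : FreeAlg 𝕜 →ₗ[𝕜] M}
    (h : ∀ w, f (mon 𝕜 w) = g (mon 𝕜 w)) : f = g :=
  (FreeAlgebra.basisFreeMonoid 𝕜 (Fin 2)).ext fun w => h w.toList

/-- The span of the monomials of degree at least `n`. -/
noncomputable def degGE (𝕜 : Type*) [Field 𝕜] (n : ℕ) : Submodule 𝕜 (FreeAlg 𝕜) :=
  Submodule.span 𝕜 (mon 𝕜 '' {w | n ≤ w.length})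

theorem mem_degGE_iff {n : ℕ} {F : FreeAlg 𝕜} :
    F ∈ degGE 𝕜 n ↔ ∀ w : List (Fin 2), coeffHom 𝕜 w F ≠ 0 → n ≤ w.length := by
  refine ((FreeAlgebra.basisFreeMonoid 𝕜 (Fin 2)).mem_span_image
    (s := {w : Word | n ≤ w.length})).trans ?_
  simp only [Set.subset_def, Finset.mem_coe, Finsupp.mem_support_iff]
  rfl

theorem mon_mem_degGE {n : ℕ} {w : List (Fin 2)} (h : n ≤ w.length) : mon 𝕜 w ∈ degGE 𝕜 n :=
  Submodule.subset_span ⟨w, h, rfl⟩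

theorem mul_mem_of_degGE {Q : Submodule 𝕜 (FreeAlg 𝕜)} {n : ℕ} {h : FreeAlg 𝕜}
    (hh : h ∈ degGE 𝕜 n) (a b : FreeAlg 𝕜)
    (H : ∀ w : List (Fin 2), n ≤ w.length → a * mon 𝕜 w * b ∈ Q) : a * h * b ∈ Q := by
  have : degGE 𝕜 n ≤ Submodule.comap (LinearMap.mulRight 𝕜 b ∘ₗ LinearMap.mulLeft 𝕜 a) Q := by
    rw [degGE, Submodule.span_le]
    rintro _ ⟨w, hw, rfl⟩
    exact H w hw
  exact this hh

theorem pderiv_mem_degGE_four (i : Fin 2) {F : FreeAlg 𝕜} (hF : F ∈ degGE 𝕜 5) :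
    pderiv i F ∈ degGE 𝕜 4 := by
  have : degGE 𝕜 5 ≤ Submodule.comap (pderiv i) (degGE 𝕜 4) := by
    rw [degGE, Submodule.span_le]
    rintro _ ⟨w, hw, rfl⟩
    change pderiv i (mon 𝕜 w) ∈ degGE 𝕜 4
    rw [pderiv_mon]
    match w, hw with
    | a :: u, hw =>
      rw [wordDeriv]
      split_ifs
      · exact mon_mem_degGE (by simpa using hw)
      · exact zero_mem _
  exact this hF

theorem coeffHom_pderiv (i : Fin 2) (w : List (Fin 2)) (F : FreeAlg 𝕜) :
    coeffHom 𝕜 w (pderiv i F) = coeffHom 𝕜 (i :: w) F := by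
  refine LinearMap.congr_fun (f := coeffHom 𝕜 w ∘ₗ pderiv i) (g := coeffHom 𝕜 (i :: w))
    (hom_ext_mon fun v => ?_) F
  rw [LinearMap.comp_apply, pderiv_mon, coeffHom_mon]
  cases v with
  | nil => simp [wordDeriv]
  | cons a u =>
    rw [wordDeriv]
    by_cases h : a = i
    · simp only [h, if_true]
      rw [← mon, coeffHom_mon]; simp
    · simp [h]

theorem coeffHom_nil_mul (a : Fin 2) (F : FreeAlg 𝕜) : coeffHom 𝕜 [] (mon 𝕜 [a] * F) = 0 := by
  refine LinearMap.congr_fun (f := coeffHom 𝕜 [] ∘ₗ LinearMap.mulLeft 𝕜 (mon 𝕜 [a])) (g := 0)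
    (hom_ext_mon fun v => ?_) F
  simp [← mon_cons, coeffHom_mon]

theorem coeffHom_nil_mul' (a : Fin 2) (F : FreeAlg 𝕜) : coeffHom 𝕜 [] (F * mon 𝕜 [a]) = 0 := by
  refine LinearMap.congr_fun (f := coeffHom 𝕜 [] ∘ₗ LinearMap.mulRight 𝕜 (mon 𝕜 [a])) (g := 0)
    (hom_ext_mon fun v => ?_) F
  simp [← mon_append, coeffHom_mon]

theorem coeffHom_cons_mul (a b : Fin 2) (w : List (Fin 2)) (F : FreeAlg 𝕜) :
    coeffHom 𝕜 (b :: w) (mon 𝕜 [a] * F) = if a = b then coeffHom 𝕜 w F else 0 := by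
  refine LinearMap.congr_fun
    (f := coeffHom 𝕜 (b :: w) ∘ₗ LinearMap.mulLeft 𝕜 (mon 𝕜 [a]))
    (g := if a = b then coeffHom 𝕜 w else 0) (hom_ext_mon fun v => ?_) F |>.trans ?_
  · simp only [LinearMap.comp_apply, LinearMap.mulLeft_apply, ← mon_cons, coeffHom_mon]
    by_cases h : a = b <;> simp [h, coeffHom_mon]
  · split_ifs <;> rfl

theorem coeffHom_concat_mul (a b : Fin 2) (w : List (Fin 2)) (F : FreeAlg 𝕜) :
    coeffHom 𝕜 (w ++ [b]) (F * mon 𝕜 [a]) = if a = b then coeffHom 𝕜 w F else 0 := by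
  refine LinearMap.congr_fun
    (f := coeffHom 𝕜 (w ++ [b]) ∘ₗ LinearMap.mulRight 𝕜 (mon 𝕜 [a]))
    (g := if a = b then coeffHom 𝕜 w else 0) (hom_ext_mon fun v => ?_) F |>.trans ?_
  · simp only [LinearMap.comp_apply, LinearMap.mulRight_apply, ← mon_append, coeffHom_mon]
    by_cases h : a = b <;> simp [h, coeffHom_mon]
  · split_ifs <;> rfl

/-- The two derivatives of a potential satisfy `x ∂ₓF + y ∂ᵧF = ∂ₓF x + ∂ᵧF y`: up to the constant
term of `F`, both sides are `F`, the right one because of cyclic invariance. This is the only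
place where cyclic invariance enters. -/
theorem syzygy {F : FreeAlg 𝕜} (hcyc : IsCyclicallyInvariant F) :
    mon 𝕜 [0] * pderiv 0 F + mon 𝕜 [1] * pderiv 1 F =
      pderiv 0 F * mon 𝕜 [0] + pderiv 1 F * mon 𝕜 [1] := by
  have hc : ∀ (b : Fin 2) (w : List (Fin 2)), coeffHom 𝕜 (b :: w) F = coeffHom 𝕜 (w ++ [b]) F :=
    fun b w => hcyc (FreeMonoid.ofList [b]) (FreeMonoid.ofList w)
  have hl : ∀ w ≠ [], coeffHom 𝕜 w (mon 𝕜 [0] * pderiv 0 F + mon 𝕜 [1] * pderiv 1 F) =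
      coeffHom 𝕜 w F := by
    intro w hw
    obtain ⟨b, w, rfl⟩ := List.exists_cons_of_ne_nil hw
    rw [map_add, coeffHom_cons_mul, coeffHom_cons_mul, coeffHom_pderiv, coeffHom_pderiv]
    fin_cases b <;> simp
  have hr : ∀ w ≠ [], coeffHom 𝕜 w (pderiv 0 F * mon 𝕜 [0] + pderiv 1 F * mon 𝕜 [1]) =
      coeffHom 𝕜 w F := by
    intro w hw
    obtain ⟨w, b, rfl⟩ := (List.eq_nil_or_concat' w).resolve_left hw
    rw [map_add, coeffHom_concat_mul, coeffHom_concat_mul, coeffHom_pderiv, coeffHom_pderiv,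
      hc, hc]
    fin_cases b <;> simp
  refine ext_coeffHom fun w => ?_
  by_cases hw : w = []
  · subst hw
    simp only [map_add, coeffHom_nil_mul, coeffHom_nil_mul']
  · rw [hl w hw, hr w hw]

/-! ### Extension of scalars -/

section BaseChange

/-- Extension of scalars `𝕜⟨x, y⟩ → L⟨x, y⟩`. -/
noncomputable def baseChange (𝕜 L : Type*) [Field 𝕜] [Field L] [Algebra 𝕜 L] :
    FreeAlg 𝕜 →ₐ[𝕜] FreeAlg L :=
  FreeAlgebra.lift 𝕜 (FreeAlgebra.ι L)

variable [Algebra 𝕜 L]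

theorem baseChange_mon (w : List (Fin 2)) : baseChange 𝕜 L (mon 𝕜 w) = mon L w := by
  induction w with
  | nil => simp [mon_nil]
  | cons a u ih =>
    rw [mon_cons, map_mul, ih, mon_cons (𝕜 := L), mon_singleton, mon_singleton]
    simp [baseChange]

theorem coeffHom_baseChange (w : List (Fin 2)) (F : FreeAlg 𝕜) :
    coeffHom L w (baseChange 𝕜 L F) = algebraMap 𝕜 L (coeffHom 𝕜 w F) := by
  refine LinearMap.congr_fun
    (f := (coeffHom L w).restrictScalars 𝕜 ∘ₗ (baseChange 𝕜 L).toLinearMap)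
    (g := Algebra.linearMap 𝕜 L ∘ₗ coeffHom 𝕜 w) (hom_ext_mon fun v => ?_) F
  simp [baseChange_mon, coeffHom_mon, apply_ite (algebraMap 𝕜 L)]

theorem baseChange_mem_degGE {n : ℕ} {F : FreeAlg 𝕜} (hF : F ∈ degGE 𝕜 n) :
    baseChange 𝕜 L F ∈ degGE L n := by
  rw [mem_degGE_iff] at *
  intro w hw
  rw [coeffHom_baseChange] at hw
  exact hF w fun h => hw (by rw [h, map_zero])

end BaseChange

/-! ### Gröbner basis of a deformation -/

/-- The word read as a binary number, the last letter being the most significant digit. -/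
def wordValue (w : List (Fin 2)) : ℕ := Nat.ofDigits 2 (w.map Fin.val)

theorem wordValue_append (u v : List (Fin 2)) :
    wordValue (u ++ v) = wordValue u + 2 ^ u.length * wordValue v := by
  simp [wordValue, Nat.ofDigits_append]

/-- The monomial order: longer words are smaller, so that the lowest-degree terms of a relation lead,
and words of equal length are compared by their values. It is well-founded on words of bounded
length. -/
def Precedes (w' w : List (Fin 2)) : Prop :=
  w.length < w'.length ∨ w'.length = w.length ∧ wordValue w' < wordValue w

theorem Precedes.append {m' m : List (Fin 2)} (h : Precedes m' m) (u v : List (Fin 2)) :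
    Precedes (u ++ m' ++ v) (u ++ m ++ v) := by
  rcases h with h | ⟨h, h'⟩
  · left
    simp only [List.length_append]
    omega
  · right
    refine ⟨by simp [h], ?_⟩
    simp only [wordValue_append, List.length_append, h]
    gcongr

/-- The leading words `xyy` and `xxy` of the two relations. -/
def lead : Fin 2 → List (Fin 2) := ![[0, 1, 1], [0, 0, 1]]

/-- The other words `yyx` and `yxx` in `∂ₓF₀` and `∂ᵧF₀`, where `F₀` is the sum of the cyclic
rotations of `xxyy`. -/
def tail : Fin 2 → List (Fin 2) := ![[1, 1, 0], [1, 0, 0]]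

theorem length_lead (i : Fin 2) : (lead i).length = 3 := by fin_cases i <;> rfl

theorem precedes_tail_lead (i : Fin 2) : Precedes (tail i) (lead i) := by
  right
  fin_cases i <;> decide

/-- The elements `r 0`, `r 1` have lowest-degree parts `xyy + yyx` and `xxy + yxx`, and they satisfy
the syzygy of the derivatives of a potential. -/
structure IsDeformation (r : Fin 2 → FreeAlg L) : Prop where
  higher : ∀ i, r i - mon L (lead i) - mon L (tail i) ∈ degGE L 4
  syzygy : mon L [0] * r 0 + mon L [1] * r 1 = r 0 * mon L [0] + r 1 * mon L [1]

namespace IsDeformation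

variable {r : Fin 2 → FreeAlg L}

theorem mul_sub_lead_mul_mem (hr : IsDeformation r) {Q : Submodule L (FreeAlg L)} (i : Fin 2)
    (a b : FreeAlg L) (H : ∀ z, Precedes z (lead i) → a * mon L z * b ∈ Q) :
    a * (r i - mon L (lead i)) * b ∈ Q := by
  have h : a * (r i - mon L (lead i)) * b = a * mon L (tail i) * b +
      a * (r i - mon L (lead i) - mon L (tail i)) * b := by noncomm_ring
  rw [h]
  refine add_mem (H _ (precedes_tail_lead i)) (mul_mem_of_degGE (hr.higher i) a b fun w hw => ?_)
  exact H w (Or.inl (by rw [length_lead]; omega))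

theorem mem_degGE_of_le_length (hr : IsDeformation r) {n : ℕ} (i : Fin 2) (u v : List (Fin 2))
    (h : n ≤ (u ++ lead i ++ v).length) : mon L u * r i * mon L v ∈ degGE L n := by
  have h' : mon L u * r i * mon L v = mon L (u ++ lead i ++ v) +
      mon L u * (r i - mon L (lead i)) * mon L v := by
    rw [mon_append, mon_append]; noncomm_ring
  rw [h']
  refine add_mem (mon_mem_degGE h) (hr.mul_sub_lead_mul_mem i _ _ fun z hz => ?_)
  rw [← mon_append, ← mon_append]
  refine mon_mem_degGE (h.trans ?_)
  rcases hz.append u v with hz | hz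
  · exact hz.le
  · exact hz.1.ge

/-- Diamond lemma. Two multiples `u (r i) v` and `u' (r j) v'` with the same leading word `w` differ
by a combination of multiples with leading words below `w`. If the two occurrences of leading
words in `w` are disjoint, both products are compared with the one where both occurrences are
replaced by relations; the only overlap, `xxyy`, is resolved by the syzygy. -/
theorem exchange_of_le (hr : IsDeformation r) {Q : Submodule L (FreeAlg L)} {w : List (Fin 2)}
    (H : ∀ k p q, Precedes (p ++ lead k ++ q) w → mon L p * r k * mon L q ∈ Q)
    {i j : Fin 2} {u v u' v' : List (Fin 2)} (h : u ++ lead i ++ v = w)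
    (h' : u' ++ lead j ++ v' = w) (hle : u.length ≤ u'.length) :
    mon L u * r i * mon L v - mon L u' * r j * mon L v' ∈ Q := by
  obtain ⟨p, rfl⟩ : u <+: u' := List.prefix_of_prefix_length_le
    (l₃ := w) ⟨lead i ++ v, by simpa using h⟩ ⟨lead j ++ v', by simpa using h'⟩ hle
  have hp : lead i ++ v = p ++ (lead j ++ v') := by
    rw [← h'] at h
    simpa using h
  match p with
  | [] =>
    obtain ⟨h1, h2⟩ := List.append_inj (s₁ := lead i) (s₂ := lead j) hp (by simp [length_lead])
    have : i = j := by
      clear h h' hp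
      revert i j
      decide
    subst this
    simp [h2]
  | [a] =>
    have hij : i = 1 ∧ j = 0 ∧ a = 0 ∧ v = 1 :: v' := by
      fin_cases i <;> fin_cases j <;> simp [lead] at hp ⊢
      exact ⟨hp.1.symm, hp.2⟩
    obtain ⟨rfl, rfl, rfl, rfl⟩ := hij
    -- The syzygy rewrites `(r 1) y - x (r 0)`, whose two terms lead with `xxyy`, as
    -- `y (r 1) - (r 0) x`, whose terms lead with `yxxy` and `xyyx`.
    have hs : r 1 * mon L [1] - mon L [0] * r 0 = mon L [1] * r 1 - r 0 * mon L [0] := by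
      rw [sub_eq_sub_iff_add_eq_add, add_comm, ← hr.syzygy, add_comm]
    have e : mon L u * r 1 * mon L (1 :: v') - mon L (u ++ [0]) * r 0 * mon L v' =
        mon L (u ++ [1]) * r 1 * mon L v' - mon L u * r 0 * mon L (0 :: v') := by
      rw [mon_cons, mon_cons 0, mon_append, mon_append]
      calc _ = mon L u * (r 1 * mon L [1] - mon L [0] * r 0) * mon L v' := by noncomm_ring
        _ = _ := by rw [hs]; noncomm_ring
    rw [e]
    have key : ∀ z, Precedes z [0, 0, 1, 1] → Precedes (u ++ z ++ v') w := fun z hz => by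
      rw [← h]; simpa [lead] using hz.append u v'
    refine sub_mem (H _ _ _ ?_) (H _ _ _ ?_)
    · simpa [lead] using key [1, 0, 0, 1] (Or.inr (by decide))
    · simpa [lead] using key [0, 1, 1, 0] (Or.inr (by decide))
  | [a, b] =>
    exfalso
    fin_cases i <;> fin_cases j <;> simp [lead] at hp
  | a :: b :: c :: m =>
    obtain ⟨h1, h2⟩ := List.append_inj (s₁ := lead i) (t₁ := v) (s₂ := [a, b, c])
      (t₂ := m ++ (lead j ++ v')) (by simpa using hp) (by simp [length_lead])
    have h3 : a :: b :: c :: m = lead i ++ m := by rw [h1]; rfl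
    rw [h3] at h' ⊢
    subst h2
    have e : mon L u * r i * mon L (m ++ (lead j ++ v')) -
        mon L (u ++ (lead i ++ m)) * r j * mon L v' =
        mon L u * (r i - mon L (lead i)) * (mon L m * r j * mon L v') -
          mon L u * r i * mon L m * (r j - mon L (lead j)) * mon L v' := by
      simp only [mon_append]
      noncomm_ring
    rw [e]
    refine sub_mem (hr.mul_sub_lead_mul_mem _ _ _ fun z hz => ?_)
      (hr.mul_sub_lead_mul_mem _ _ _ fun z hz => ?_)
    · have := H j (u ++ z ++ m) v' (by
        rw [← h']; simpa using hz.append u (m ++ (lead j ++ v')))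
      simpa only [mon_append, mul_assoc] using this
    · have := H i u (m ++ z ++ v') (by
        rw [← h]; simpa using hz.append (u ++ (lead i ++ m)) v')
      simpa only [mon_append, mul_assoc] using this

theorem exchange (hr : IsDeformation r) {Q : Submodule L (FreeAlg L)} {w : List (Fin 2)}
    (H : ∀ k p q, Precedes (p ++ lead k ++ q) w → mon L p * r k * mon L q ∈ Q)
    {i j : Fin 2} {u v u' v' : List (Fin 2)} (h : u ++ lead i ++ v = w)
    (h' : u' ++ lead j ++ v' = w) :
    mon L u * r i * mon L v - mon L u' * r j * mon L v' ∈ Q := by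
  rcases le_total u.length u'.length with hle | hle
  · exact hr.exchange_of_le H h h' hle
  · rw [← neg_sub]
    exact neg_mem (hr.exchange_of_le H h' h hle)

/-- If `Q` contains everything of degree at least `N` and, for each shorter word containing a leading
word, one multiple of a relation with that word as leading word, then `Q` contains all multiples
of the relations. -/
theorem mem_of_representatives (hr : IsDeformation r) {N : ℕ} {Q : Submodule L (FreeAlg L)}
    (hN : degGE L N ≤ Q)
    (hQ : ∀ i u v, (u ++ lead i ++ v).length < N → ∃ j u' v',
      u' ++ lead j ++ v' = u ++ lead i ++ v ∧ mon L u' * r j * mon L v' ∈ Q)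
    (i : Fin 2) (u v : List (Fin 2)) : mon L u * r i * mon L v ∈ Q := by
  by_cases hlen : (u ++ lead i ++ v).length < N
  · obtain ⟨j, u', v', h, hmem⟩ := hQ i u v hlen
    rw [← sub_add_cancel (mon L u * r i * mon L v) (mon L u' * r j * mon L v')]
    refine add_mem (hr.exchange (fun k p q hk => ?_) rfl h) hmem
    exact mem_of_representatives hr hN hQ k p q
  · exact hN (hr.mem_degGE_of_le_length i u v (not_lt.1 hlen))
termination_by (N - (u ++ lead i ++ v).length, wordValue (u ++ lead i ++ v))
decreasing_by
  rcases hk with hk | ⟨hk, hk'⟩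
  · exact Prod.Lex.left _ _ (by omega)
  · rw [hk]
    exact Prod.Lex.right _ hk'

end IsDeformation

/-! ### Truncation and codimension -/

/-- Words of length less than `N`. -/
abbrev ShortWord (N : ℕ) : Type := {w : List (Fin 2) // w.length < N}

instance (N : ℕ) : Finite (ShortWord N) := (List.finite_length_lt (Fin 2) N).to_subtype

/-- Truncation of `L⟨x, y⟩` below degree `N`, as the vector of coefficients of the short words. -/
noncomputable def trunc (L : Type*) [Field L] (N : ℕ) : FreeAlg L →ₗ[L] (ShortWord N → L) :=
  LinearMap.pi fun w => coeffHom L w.1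

theorem trunc_eq_zero {N : ℕ} {F : FreeAlg L} (hF : F ∈ degGE L N) : trunc L N F = 0 := by
  funext w
  by_contra h
  exact absurd w.2 (not_lt.2 (mem_degGE_iff.1 hF w.1 h))

theorem trunc_surjective (N : ℕ) : Function.Surjective (trunc L N) := by
  have := Fintype.ofFinite (ShortWord N)
  intro f
  refine ⟨∑ w : ShortWord N, f w • mon L w.1, funext fun w => ?_⟩
  classical
  simp [trunc, coeffHom_mon, Subtype.coe_inj]

/-- The word contains one of the leading words. -/
def Reducible (w : List (Fin 2)) : Prop := ∃ i u v, u ++ lead i ++ v = w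

theorem not_reducible_replicate (n : ℕ) : ¬ Reducible (List.replicate n 1) := by
  rintro ⟨i, u, v, h⟩
  have h0 : (0 : Fin 2) ∈ lead i := by fin_cases i <;> simp [lead]
  have : (0 : Fin 2) ∈ List.replicate n (1 : Fin 2) := h ▸ by simp [h0]
  simpa using List.eq_of_mem_replicate this

/-- At least `N` short words are irreducible, namely the powers of `y`. -/
theorem card_reducible_add_le (N : ℕ) :
    Nat.card {w : ShortWord N // Reducible w.1} + N ≤ Nat.card (ShortWord N) := by
  let f : {w : ShortWord N // Reducible w.1} ⊕ Fin N → ShortWord N :=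
    Sum.elim Subtype.val fun n => ⟨List.replicate n 1, by simp⟩
  have hf : Function.Injective f := by
    refine Subtype.val_injective.sumElim (fun m n h => ?_) fun w n h => ?_
    · have := congrArg (fun w : ShortWord N => w.1.length) h
      simpa [Fin.ext_iff] using this
    · exact not_reducible_replicate n ((congrArg (fun w : ShortWord N => Reducible w.1) h).mp w.2)
  simpa using Nat.card_le_card_of_injective f hf

/-- Below degree `N`, the ideal generated by the relations has codimension at least `N`. -/
theorem IsDeformation.finrank_add_le {r : Fin 2 → FreeAlg L} (hr : IsDeformation r) (N : ℕ) :
    finrank L (Submodule.span L (Set.range fun p : Fin 2 × List (Fin 2) × List (Fin 2) =>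
      trunc L N (mon L p.2.1 * r p.1 * mon L p.2.2))) + N ≤ Nat.card (ShortWord N) := by
  have := Fintype.ofFinite {w : ShortWord N // Reducible w.1}
  choose i u v h using fun w : {w : ShortWord N // Reducible w.1} => w.2
  let E (w : {w : ShortWord N // Reducible w.1}) : FreeAlg L :=
    mon L (u w) * r (i w) * mon L (v w)
  have hle : Submodule.span L (Set.range fun p : Fin 2 × List (Fin 2) × List (Fin 2) =>
      trunc L N (mon L p.2.1 * r p.1 * mon L p.2.2)) ≤
      Submodule.span L (Set.range (trunc L N ∘ E)) := by
    rw [Submodule.span_le]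
    rintro _ ⟨⟨k, p, q⟩, rfl⟩
    refine hr.mem_of_representatives (N := N)
      (Q := (Submodule.span L (Set.range (trunc L N ∘ E))).comap (trunc L N))
      (fun F hF => ?_) (fun k p q hk => ?_) k p q
    · rw [Submodule.mem_comap, trunc_eq_zero hF]
      exact zero_mem _
    · let w : {w : ShortWord N // Reducible w.1} := ⟨⟨_, hk⟩, k, p, q, rfl⟩
      exact ⟨i w, u w, v w, h w, Submodule.subset_span ⟨w, rfl⟩⟩
  have hcard := (Submodule.finrank_mono hle).trans (finrank_range_le_card (R := L) (trunc L N ∘ E))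
  rw [← Nat.card_eq_fintype_card] at hcard
  exact (Nat.add_le_add_right hcard N).trans (card_reducible_add_le N)

/-! ### The deformed potential -/

section Deformation

variable [Algebra 𝕜 L]

theorem hasTermsOfDegreeGE_iff {d : ℕ} {F : FreeAlg 𝕜} :
    HasTermsOfDegreeGE d F ↔ F ∈ degGE 𝕜 d := mem_degGE_iff.symm

/-- The derivative of the potential `F₀ + t F`, where `F₀` is the sum of the cyclic rotations of
`xxyy`. -/
noncomputable def deform (F : FreeAlg 𝕜) (t : L) (i : Fin 2) : FreeAlg L :=
  mon L (lead i) + mon L (tail i) + t • baseChange 𝕜 L (pderiv i F)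

theorem isDeformation_deform {F : FreeAlg 𝕜} (hcyc : IsCyclicallyInvariant F)
    (hF : F ∈ degGE 𝕜 5) (t : L) : IsDeformation (deform F t) where
  higher i := by
    have h : deform F t i - mon L (lead i) - mon L (tail i) =
        t • baseChange 𝕜 L (pderiv i F) := by rw [deform]; abel
    rw [h]
    exact Submodule.smul_mem _ _ (baseChange_mem_degGE (pderiv_mem_degGE_four i hF))
  syzygy := by
    have hs := congrArg (baseChange 𝕜 L) (syzygy hcyc)
    simp only [map_add, map_mul, baseChange_mon] at hs
    -- `F₀` satisfies the syzygy as well.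
    have h0 : mon L [0] * (mon L (lead 0) + mon L (tail 0)) +
        mon L [1] * (mon L (lead 1) + mon L (tail 1)) =
        (mon L (lead 0) + mon L (tail 0)) * mon L [0] +
        (mon L (lead 1) + mon L (tail 1)) * mon L [1] := by
      simp only [mul_add, add_mul, ← mon_append]
      simp only [lead, tail, Matrix.cons_val_zero, Matrix.cons_val_one, List.cons_append,
        List.nil_append]
      abel
    simp only [deform, mul_add, add_mul, mul_smul_comm, smul_mul_assoc] at h0 ⊢
    have hs' := congrArg (t • ·) hs
    simp only [smul_add] at hs'
    refine Eq.trans ?_ ((congrArg₂ (· + ·) h0 hs').trans ?_) <;> abel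

theorem trunc_baseChange (N : ℕ) (F : FreeAlg 𝕜) (w : ShortWord N) :
    trunc L N (baseChange 𝕜 L F) w = algebraMap 𝕜 L (trunc 𝕜 N F w) :=
  coeffHom_baseChange w.1 F

theorem trunc_deform (N : ℕ) (F : FreeAlg 𝕜) (t : L) (i : Fin 2) (u v : List (Fin 2))
    (w : ShortWord N) :
    trunc L N (mon L u * deform F t i * mon L v) w =
      algebraMap 𝕜 L (trunc 𝕜 N (mon 𝕜 u * (mon 𝕜 (lead i) + mon 𝕜 (tail i)) * mon 𝕜 v) w) +
        t * algebraMap 𝕜 L (trunc 𝕜 N (mon 𝕜 u * pderiv i F * mon 𝕜 v) w) := by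
  rw [← trunc_baseChange, ← trunc_baseChange, ← smul_eq_mul t, ← Pi.smul_apply, ← map_smul,
    ← Pi.add_apply, ← map_add]
  simp only [map_mul, map_add, baseChange_mon, deform, mul_add, add_mul, mul_smul_comm,
    smul_mul_assoc]

/-- The codimension bound for the deformed relations over `𝕜(t)` descends to the relations of `F`,
since the rank cannot drop under the deformation. -/
theorem finrank_span_trunc_add_le {F : FreeAlg 𝕜} (hcyc : IsCyclicallyInvariant F)
    (hF : F ∈ degGE 𝕜 5) (N : ℕ) :
    finrank 𝕜 (Submodule.span 𝕜 (Set.range fun p : Fin 2 × List (Fin 2) × List (Fin 2) =>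
      trunc 𝕜 N (mon 𝕜 p.2.1 * pderiv p.1 F * mon 𝕜 p.2.2))) + N ≤ Nat.card (ShortWord N) := by
  obtain ⟨κ, a, -, hspan, hli⟩ := exists_linearIndependent' 𝕜
    fun p : Fin 2 × List (Fin 2) × List (Fin 2) =>
      trunc 𝕜 N (mon 𝕜 p.2.1 * pderiv p.1 F * mon 𝕜 p.2.2)
  have := Fintype.ofFinite (ShortWord N)
  have : Finite κ := hli.finite
  have := Fintype.ofFinite κ
  rw [← hspan, finrank_span_eq_card hli]
  have hL := hli.add_transcendental_smul (RatFunc.transcendental_X (K := 𝕜)) fun k =>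
    trunc 𝕜 N (mon 𝕜 (a k).2.1 * (mon 𝕜 (lead (a k).1) + mon 𝕜 (tail (a k).1)) *
      mon 𝕜 (a k).2.2)
  have hcard := finrank_span_eq_card hL
  rw [← hcard]
  refine le_trans (Nat.add_le_add_right (Submodule.finrank_mono (Submodule.span_mono ?_)) N)
    ((isDeformation_deform hcyc hF (RatFunc.X (K := 𝕜))).finrank_add_le N)
  rintro _ ⟨k, rfl⟩
  exact ⟨a k, funext fun w => trunc_deform N F _ _ _ _ w⟩

end Deformation

/-! ### The potential algebra -/

theorem mem_span_of_mem_potentialIdeal {F G : FreeAlg 𝕜} (hG : G ∈ potentialIdeal F) :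
    G ∈ Submodule.span 𝕜 (Set.range fun p : Fin 2 × List (Fin 2) × List (Fin 2) =>
      mon 𝕜 p.2.1 * pderiv p.1 F * mon 𝕜 p.2.2) := by
  rw [potentialIdeal, TwoSidedIdeal.mem_span_iff_mem_addSubgroup_closure] at hG
  refine (AddSubgroup.closure_le (Submodule.span 𝕜 (Set.range fun p :
    Fin 2 × List (Fin 2) × List (Fin 2) =>
      mon 𝕜 p.2.1 * pderiv p.1 F * mon 𝕜 p.2.2)).toAddSubgroup).2 ?_ hG
  rintro _ ⟨_, ⟨a, -, s, hs, rfl⟩, b, -, rfl⟩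
  have h : a * s * b ∈ Submodule.span 𝕜 (Set.range (mon 𝕜)) *
      Submodule.span 𝕜 {pderiv 0 F, pderiv 1 F} * Submodule.span 𝕜 (Set.range (mon 𝕜)) := by
    rw [span_mon]
    exact Submodule.mul_mem_mul (Submodule.mul_mem_mul Submodule.mem_top
      (Submodule.subset_span hs)) Submodule.mem_top
  rw [Submodule.span_mul_span, Submodule.span_mul_span] at h
  refine Submodule.span_mono ?_ h
  rintro _ ⟨_, ⟨_, ⟨u, rfl⟩, s, hs, rfl⟩, _, ⟨v, rfl⟩, rfl⟩
  rcases hs with rfl | rfl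
  · exact ⟨(0, u, v), rfl⟩
  · exact ⟨(1, u, v), rfl⟩

/-- The quotient map onto `A_F`, as a linear map. -/
noncomputable def toPotentialAlg (F : FreeAlg 𝕜) : FreeAlg 𝕜 →ₗ[𝕜] PotentialAlg F where
  toFun G := (G : PotentialAlg F)
  map_add' _ _ := rfl
  map_smul' _ _ := rfl

theorem toPotentialAlg_surjective (F : FreeAlg 𝕜) : Function.Surjective (toPotentialAlg F) :=
  Quotient.mk''_surjective

theorem mem_ker_toPotentialAlg {F G : FreeAlg 𝕜} :
    G ∈ (toPotentialAlg F).ker ↔ G ∈ potentialIdeal F := by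
  rw [LinearMap.mem_ker, TwoSidedIdeal.mem_iff]
  exact Quotient.eq''

theorem le_finrank_potentialAlg {F : FreeAlg 𝕜} (hcyc : IsCyclicallyInvariant F)
    (hF : F ∈ degGE 𝕜 5) [FiniteDimensional 𝕜 (PotentialAlg F)] (N : ℕ) :
    N ≤ finrank 𝕜 (PotentialAlg F) := by
  have := Fintype.ofFinite (ShortWord N)
  set I := (toPotentialAlg F).ker
  set S := Submodule.span 𝕜 (Set.range fun p : Fin 2 × List (Fin 2) × List (Fin 2) =>
      trunc 𝕜 N (mon 𝕜 p.2.1 * pderiv p.1 F * mon 𝕜 p.2.2)) with hS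
  have hI : I ≤ S.comap (trunc 𝕜 N) := by
    intro G hG
    have := Submodule.mem_map_of_mem (f := trunc 𝕜 N)
      (mem_span_of_mem_potentialIdeal (mem_ker_toPotentialAlg.1 hG))
    rw [Submodule.map_span, ← Set.range_comp] at this
    exact this
  let e := (toPotentialAlg F).quotKerEquivOfSurjective (toPotentialAlg_surjective F)
  have hsurj : Function.Surjective (I.mapQ S (trunc 𝕜 N) hI ∘ₗ e.symm.toLinearMap) := by
    rw [LinearMap.coe_comp]
    refine Function.Surjective.comp ?_ e.symm.surjective
    rw [← LinearMap.range_eq_top, Submodule.range_mapQ,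
      LinearMap.range_eq_top.2 (trunc_surjective N), Submodule.map_top, Submodule.range_mkQ]
  have h1 := LinearMap.finrank_le_finrank_of_surjective hsurj
  have h2 := Submodule.finrank_quotient_add_finrank S
  have h3 := finrank_span_trunc_add_le hcyc hF N
  rw [finrank_fintype_fun_eq_card, ← Nat.card_eq_fintype_card] at h2
  rw [← hS] at h3
  omega

end PotentialAlgebra

theorem theorem2p3 {𝕜 : Type*} [Field 𝕜] (F : PotentialAlgebra.FreeAlg 𝕜)
    (hcyc : PotentialAlgebra.IsCyclicallyInvariant F)
    (hdeg : PotentialAlgebra.HasTermsOfDegreeGE 5 F) :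
    ¬ FiniteDimensional 𝕜 (PotentialAlgebra.PotentialAlg F) := by
  intro h
  have := PotentialAlgebra.le_finrank_potentialAlg hcyc (PotentialAlgebra.hasTermsOfDegreeGE_iff.1 hdeg)
    (Module.finrank 𝕜 (PotentialAlgebra.PotentialAlg F) + 1)
  omega
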